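/- Let $d\ge 1$ be an integer. Let $U$ be the hyperbolic plane, $E_8$ the positive $E_8$-lattice, and let $(V_{2d},\psi_{2d})=\bigl(\langle 2d\rangle\oplus U^{\oplus 2}\oplus E_8^{\oplus 2}\bigr)\otimes\mathbb{Q}$, a quadratic space of dimension $21$ and signature $(2-,19+)$; for $e\ge1$ define $(V_{2e},\psi_{2e})$ in the same way. Put $G=\mathrm{SO}(V_{2d},\psi_{2d})$, let $\mathbb{A}_f$ be the ring of finite adèles of $\mathbb{Q}$ and let $\mathbb{K}\subset G(\mathbb{A}_f)$ be a compact open subgroup. Let $\mathbb{S}=\mathrm{Res}_{\mathbb{C}/\mathbb{R}}\mathbb{G}_m$. A Hodge structure $h\colon\mathbb{S}\to\mathrm{GL}(W_\mathbb{R})$ acts on $W^{p,q}$ by $z^{-p}\bar z^{-q}$; in weight $0$ a polarization is an $h$-invariant form $s\colon W\times W\to\mathbb{Q}$ such that $s(x,h(i)y)$ is symmetric and positive definite on $W_\mathbb{R}$. Let $\Omega^{\pm}$ be the set of Hodge structures $h\colon\mathbb{S}\to G_\mathbb{R}$ on $V_{2d}$ with Hodge numbers $h^{-1,1}=h^{1,-1}=1$,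 $h^{0,0}=19$ for which $\psi_{2d}$ or $-\psi_{2d}$ is a polarization, and let $$Sh_\mathbb{K}(G,\Omega^\pm)_\mathbb{C}(\mathbb{C})=G(\mathbb{Q})\backslash\Omega^\pm\times G(\mathbb{A}_f)/\mathbb{K},\qquad q(x,g)k=(q\cdot x,qgk),$$ with $q\cdot x = (z\mapsto q\,x(z)\,q^{-1})$; write $[x,g]_\mathbb{K}$ for the class of $(x,g)$. A polarized $\mathbb{Q}$-Hodge structure of K3 type of degree $2e$ is a triple $(W,s,h)$ with $h\colon \mathbb{S}\to\mathrm{SO}(W,s)_\mathbb{R}$ a $\mathbb{Q}$-Hodge structure of type $\{(-1,1),(0,0),(1,-1)\}$ with Hodge numbers $1,19,1$, polarized by $s$, such that $(W,s)\cong(V_{2e},\psi_{2e})$ as quadratic spaces over $\mathbb{Q}$; it is of K3 type if this holds for some $e\ge 1$. Let $\mathcal{H}_\mathbb{K}$ be the collection of all $\bigl((W,h),s,\alpha\mathbb{K}\bigr)$ where $(W,s,h)$ is a polarized $\mathbb{Q}$-Hodge structure of K3 type and $\alpha\mathbb{K}$ is the $\mathbb{K}$-orbit of an $\mathbb{A}_f$-linear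 isomorphism $\alpha\colon V_{2d}\otimes\mathbb{A}_f\to W\otimes\mathbb{A}_f$ such that $\psi_{2d}(v_1,v_2)=m_s\cdot s(\alpha v_1,\alpha v_2)$ for all $v_1,v_2$, with some $m_s\in\mathbb{Q}_{>0}$, and such that the determinant of $\alpha$ with respect to $\mathbb{Q}$-bases of $V_{2d}$ and $W$ lies in $\mathbb{Q}^\times\subset\mathbb{A}_f^\times$. An isomorphism from $\bigl((W,h),s,\alpha\mathbb{K}\bigr)$ to $\bigl((W',h'),s',\alpha'\mathbb{K}\bigr)$ is an isomorphism $b\colon(W,h)\to(W',h')$ of $\mathbb{Q}$-Hodge structures such that $s=c\cdot s'\circ(b\times b)$ for some $c\in\mathbb{Q}^\times$ and $b\circ\alpha\in\alpha'\mathbb{K}$. Then for every $\bigl((W,h),s,\alpha\mathbb{K}\bigr)\in\mathcal{H}_\mathbb{K}$ and every representative $\alpha$ of $\alpha\mathbb{K}$ there is a $\mathbb{Q}$-linear isomorphism $a\colon W\to V_{2d}$ with $s=m_s^{-1}\cdot\psi_{2d}\circ(a\times a)$ and $a\circ\alpha\in G(\mathbb{A}_f)$. For every such $a$, the homomorphism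 $a\cdot h=(z\mapsto a\,h(z)\,a^{-1})$ lies in $\Omega^\pm$, and the class $[a\cdot h,a\circ\alpha]_\mathbb{K}$ depends neither on $a$ nor on the representative $\alpha$, and only on the isomorphism class of $\bigl((W,h),s,\alpha\mathbb{K}\bigr)$. The resulting map $$\mathcal{H}_\mathbb{K}/\{\text{isom.}\}\longrightarrow Sh_\mathbb{K}(G,\Omega^\pm)_\mathbb{C}(\mathbb{C}),\qquad \bigl((W,h),s,\alpha\mathbb{K}\bigr)\mapsto[a\cdot h,a\circ\alpha]_\mathbb{K}$$ is a bijection, and every point of $Sh_\mathbb{K}(G,\Omega^\pm)_\mathbb{C}(\mathbb{C})$ is the image of an object whose Hodge structure has degree $2d$ (so the map restricted to objects of degree $2d$ is a bijection as well). -/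

import Mathlib

open scoped TensorProduct

noncomputable section

namespace K3Shimura

/-! ### The quadratic spaces `(V_{2d}, ψ_{2d})` -/

/-- The index set of the standard basis of `L_{2d} = ⟨e₁ + d f₁⟩ ⊕ U ⊕ U ⊕ E₈ ⊕ E₈`
(rank `21`). -/
abbrev Idx : Type := Fin 1 ⊕ (Fin 2 ⊕ Fin 2) ⊕ (Fin 8 ⊕ Fin 8)

/-- The Gram matrix of the hyperbolic plane. -/
def gramU : Matrix (Fin 2) (Fin 2) ℤ := !![0, 1; 1, 0]

/-- The Gram matrix of `L_{2d}`. The vector `e₁ + d f₁` of the hyperbolic plane has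
self-pairing `2d`, and the Gram matrix of the positive lattice `E₈` is the Cartan matrix. -/
def gram (d : ℕ) : Matrix Idx Idx ℤ :=
  Matrix.fromBlocks !![2 * (d : ℤ)] 0 0
    (Matrix.fromBlocks (Matrix.fromBlocks gramU 0 0 gramU) 0 0
      (Matrix.fromBlocks CartanMatrix.E₈ 0 0 CartanMatrix.E₈))

/-- The vector space `V_{2d} = L_{2d} ⊗ ℚ`; only the form depends on `d`. -/
abbrev V : Type := Idx → ℚ

/-- The bilinear form `ψ_{2d}` on `V_{2d}`. -/
def ψ (d : ℕ) : LinearMap.BilinForm ℚ V :=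
  Matrix.toBilin' ((gram d).map (Int.cast : ℤ → ℚ))

/-- The ring of finite adèles of `ℚ`. -/
abbrev Af : Type := IsDedekindDomain.FiniteAdeleRing ℤ ℚ

/-! ### Special orthogonal groups -/

/-- The special orthogonal group of a bilinear form on an `R`-module. -/
def SO {R M : Type*} [CommRing R] [AddCommGroup M] [Module R M]
    (B : LinearMap.BilinForm R M) : Subgroup (M ≃ₗ[R] M) where
  carrier := {g | (∀ x y, B (g x) (g y) = B x y) ∧ LinearMap.det (g : M →ₗ[R] M) = 1}
  one_mem' := ⟨fun _ _ => rfl, LinearMap.det_id⟩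
  mul_mem' := by
    rintro a b ⟨ha, ha'⟩ ⟨hb, hb'⟩
    refine ⟨fun x y => ?_, ?_⟩
    · rw [LinearEquiv.mul_apply, LinearEquiv.mul_apply, ha, hb]
    · have : ((a * b : M ≃ₗ[R] M) : M →ₗ[R] M) = (a : M →ₗ[R] M) * (b : M →ₗ[R] M) := rfl
      rw [this, map_mul, ha', hb', one_mul]
  inv_mem' := by
    rintro a ⟨ha, ha'⟩
    refine ⟨fun x y => ?_, ?_⟩
    · have h := ha (a⁻¹ x) (a⁻¹ y)
      rw [← LinearEquiv.mul_apply, ← LinearEquiv.mul_apply, mul_inv_cancel] at h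
      exact h.symm
    · have : (a : M →ₗ[R] M) * ((a⁻¹ : M ≃ₗ[R] M) : M →ₗ[R] M) = 1 := by
        ext x
        exact a.apply_symm_apply x
      have h := congrArg LinearMap.det this
      rw [map_mul, ha', one_mul, map_one] at h
      exact h

/-- `G(ℚ)` for `G = SO(V_{2d}, ψ_{2d})`. -/
abbrev GQ (d : ℕ) : Subgroup (V ≃ₗ[ℚ] V) := SO (ψ d)

/-- `G(𝔸_f)` for `G = SO(V_{2d}, ψ_{2d})`. -/
abbrev GAf (d : ℕ) : Subgroup ((Af ⊗[ℚ] V) ≃ₗ[Af] (Af ⊗[ℚ] V)) := SO ((ψ d).baseChange Af)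

/-- The adelic topology on `G(𝔸_f)`: the one induced by the matrix entries with respect to a
rational basis. (Since `g⁻¹` is a polynomial in the entries of `g` on `SO`, this is also the
topology induced from the unit group of the matrix ring.) -/
instance adelicTopology (d : ℕ) : TopologicalSpace (GAf d) :=
  TopologicalSpace.induced
    (fun g => LinearMap.toMatrix
      (Algebra.TensorProduct.basis Af (Pi.basisFun ℚ Idx))
      (Algebra.TensorProduct.basis Af (Pi.basisFun ℚ Idx))
      ((g : (Af ⊗[ℚ] V) ≃ₗ[Af] (Af ⊗[ℚ] V)) : (Af ⊗[ℚ] V) →ₗ[Af] (Af ⊗[ℚ] V)))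
    inferInstance

/-! ### Hodge structures -/

section Hodge

variable {W W' W'' : Type} [AddCommGroup W] [Module ℚ W] [AddCommGroup W'] [Module ℚ W']
  [AddCommGroup W''] [Module ℚ W'']

/-- A homomorphism `𝕊(ℝ) = ℂˣ → GL(W_ℝ)`. It comes from a (unique) homomorphism of real
algebraic groups `𝕊 → GL(W_ℝ)` if and only if `W_ℂ` is spanned by the subspaces
`hodgePiece` below; this is part of `IsK3HodgeStructure`. -/
abbrev Rep (W : Type) [AddCommGroup W] [Module ℚ W] : Type :=
  ℂˣ →* ((ℝ ⊗[ℚ] W) ≃ₗ[ℝ] (ℝ ⊗[ℚ] W))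

/-- The subspace `W^{p,q}` of `W_ℂ`, on which `h(z)` acts as `z^{-p} z̄^{-q}`. -/
def hodgePiece (h : Rep W) (p q : ℤ) : Submodule ℂ (ℂ ⊗[ℝ] (ℝ ⊗[ℚ] W)) :=
  ⨅ z : ℂˣ, Module.End.eigenspace
    (((h z : (ℝ ⊗[ℚ] W) ≃ₗ[ℝ] (ℝ ⊗[ℚ] W)) : (ℝ ⊗[ℚ] W) →ₗ[ℝ] (ℝ ⊗[ℚ] W)).baseChange ℂ)
    ((z : ℂ) ^ (-p) * (starRingEnd ℂ (z : ℂ)) ^ (-q))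

/-- `h` is a `ℚ`-Hodge structure of type `{(-1,1), (0,0), (1,-1)}` with Hodge numbers
`h^{-1,1} = h^{1,-1} = 1` and `h^{0,0} = 19`. -/
structure IsK3HodgeStructure (h : Rep W) : Prop where
  type_eq : hodgePiece h (-1) 1 ⊔ hodgePiece h 0 0 ⊔ hodgePiece h 1 (-1) = ⊤
  finrank_neg : Module.finrank ℂ (hodgePiece h (-1) 1) = 1
  finrank_zero : Module.finrank ℂ (hodgePiece h 0 0) = 19
  finrank_pos : Module.finrank ℂ (hodgePiece h 1 (-1)) = 1

/-- The element `i` of `ℂˣ`. -/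
def unitI : ℂˣ := Units.mk0 Complex.I Complex.I_ne_zero

/-- `s` is a polarization of the weight-zero Hodge structure `h`: it is a morphism of Hodge
structures `W ⊗ W → ℚ(0)`, and `s(x, h(i) y)` is symmetric and positive definite on `W_ℝ`. -/
structure IsPolarization (s : LinearMap.BilinForm ℚ W) (h : Rep W) : Prop where
  invariant : ∀ z x y, s.baseChange ℝ (h z x) (h z y) = s.baseChange ℝ x y
  symm : ∀ x y, s.baseChange ℝ x (h unitI y) = s.baseChange ℝ y (h unitI x)
  pos : ∀ x, x ≠ 0 → 0 < s.baseChange ℝ x (h unitI x)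

/-- `(W, s, h)` is a polarized `ℚ`-Hodge structure of K3 type of degree `2d`. -/
structure IsPolarizedK3OfDegree (d : ℕ) (s : LinearMap.BilinForm ℚ W) (h : Rep W) : Prop where
  mem_SO : ∀ z, h z ∈ SO (s.baseChange ℝ)
  hodge : IsK3HodgeStructure h
  polarization : IsPolarization s h
  equivalent : ∃ u : W ≃ₗ[ℚ] V, ∀ x y, ψ d (u x) (u y) = s x y

/-- `(W, s, h)` is a polarized `ℚ`-Hodge structure of K3 type, of some degree. -/
def IsPolarizedK3 (s : LinearMap.BilinForm ℚ W) (h : Rep W) : Prop :=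
  ∃ e : ℕ, 0 < e ∧ IsPolarizedK3OfDegree e s h

/-- Base change of a `ℚ`-linear isomorphism. -/
abbrev bc (R : Type) [CommRing R] [Algebra ℚ R] (a : W ≃ₗ[ℚ] W') :
    (R ⊗[ℚ] W) ≃ₗ[R] (R ⊗[ℚ] W') :=
  LinearEquiv.baseChange ℚ R W W' a

/-- Transport of structure: `a · h = (z ↦ a ∘ h(z) ∘ a⁻¹)`. -/
def transport (a : W ≃ₗ[ℚ] W') (h : Rep W) : Rep W' where
  toFun z := ((bc ℝ a).symm ≪≫ₗ h z) ≪≫ₗ bc ℝ a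
  map_one' := by ext x; simp
  map_mul' z w := by ext x; simp

theorem bc_refl (R : Type) [CommRing R] [Algebra ℚ R] :
    bc R (LinearEquiv.refl ℚ W) = LinearEquiv.refl R (R ⊗[ℚ] W) := by
  apply LinearEquiv.toLinearMap_injective
  ext x
  simp

theorem bc_trans (R : Type) [CommRing R] [Algebra ℚ R] (a : W ≃ₗ[ℚ] W') (b : W' ≃ₗ[ℚ] W'') :
    bc R (a ≪≫ₗ b) = bc R a ≪≫ₗ bc R b := by
  apply LinearEquiv.toLinearMap_injective
  ext x
  simp

theorem bc_symm (R : Type) [CommRing R] [Algebra ℚ R] (a : W ≃ₗ[ℚ] W') :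
    bc R a.symm = (bc R a).symm := by
  apply LinearEquiv.toLinearMap_injective
  ext x
  simp

theorem transport_refl (h : Rep W) : transport (LinearEquiv.refl ℚ W) h = h := by
  ext z x
  simp [transport, bc_refl]

theorem transport_trans (a : W ≃ₗ[ℚ] W') (b : W' ≃ₗ[ℚ] W'') (h : Rep W) :
    transport (a ≪≫ₗ b) h = transport b (transport a h) := by
  ext z x
  simp [transport, bc_trans]

theorem transport_symm {a : W ≃ₗ[ℚ] W'} {h : Rep W} {h' : Rep W'} (H : transport a h = h') :
    transport a.symm h' = h := by
  rw [← H, ← transport_trans, LinearEquiv.self_trans_symm, transport_refl]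

end Hodge

/-! ### The Shimura variety -/

/-- The domain `Ω^±`: all Hodge structures `h : 𝕊 → SO(V_{2d}, ψ_{2d})_ℝ` with Hodge numbers
`(1, 19, 1)` for which `ψ_{2d}` or `-ψ_{2d}` is a polarization. -/
def Ω (d : ℕ) : Set (Rep V) :=
  {h | (∀ z, h z ∈ SO ((ψ d).baseChange ℝ)) ∧ IsK3HodgeStructure h ∧
    (IsPolarization (ψ d) h ∨ IsPolarization (-ψ d) h)}

/-- `(x, g) ∼ (q x, q g k)` for `q ∈ G(ℚ)` and `k ∈ K`. -/
def shSetoid (d : ℕ) (K : Subgroup (GAf d)) : Setoid (Ω d × GAf d) where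
  r p p' := ∃ q ∈ GQ d, ∃ k ∈ K, (p'.1 : Rep V) = transport q (p.1 : Rep V) ∧
    (p'.2 : (Af ⊗[ℚ] V) ≃ₗ[Af] (Af ⊗[ℚ] V)) = bc Af q * p.2 * k
  iseqv := by
    refine ⟨fun p => ?_, ?_, ?_⟩
    · refine ⟨1, one_mem _, 1, one_mem _, (transport_refl _).symm, ?_⟩
      have : bc Af (1 : V ≃ₗ[ℚ] V) = 1 := bc_refl Af
      rw [this]
      simp
    · rintro p p' ⟨q, hq, k, hk, h1, h2⟩
      refine ⟨q⁻¹, inv_mem hq, k⁻¹, inv_mem hk, (transport_symm h1.symm).symm, ?_⟩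
      have : bc Af (q⁻¹ : V ≃ₗ[ℚ] V) = (bc Af q)⁻¹ := bc_symm Af q
      rw [this, h2]
      simp [mul_assoc]
    · rintro p p' p'' ⟨q, hq, k, hk, h1, h2⟩ ⟨q', hq', k', hk', h1', h2'⟩
      refine ⟨q' * q, mul_mem hq' hq, k * k', mul_mem hk hk', ?_, ?_⟩
      · rw [h1', h1]
        exact (transport_trans q q' _).symm
      · have : bc Af (q' * q : V ≃ₗ[ℚ] V) = bc Af q' * bc Af q := bc_trans Af q q'
        rw [this, h2', h2]
        simp [mul_assoc]

/-- The set `G(ℚ) \ Ω^± × G(𝔸_f) / K` of complex points of the Shimura variety. -/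
def Sh (d : ℕ) (K : Subgroup (GAf d)) : Type := Quotient (shSetoid d K)

/-- The class `[x, g]_K`. -/
def Sh.mk {d : ℕ} (K : Subgroup (GAf d)) (x : Ω d) (g : GAf d) : Sh d K :=
  Quotient.mk (shSetoid d K) (x, g)

/-! ### Hodge structures with a level structure -/

/-- `α : V_{2d} ⊗ 𝔸_f → W ⊗ 𝔸_f` satisfies `ψ_{2d}(v₁, v₂) = m · s(α v₁, α v₂)`. -/
def IsSimilitude {W : Type} [AddCommGroup W] [Module ℚ W] (d : ℕ)
    (s : LinearMap.BilinForm ℚ W) (m : ℚ) (α : (Af ⊗[ℚ] V) ≃ₗ[Af] (Af ⊗[ℚ] W)) : Prop :=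
  ∀ v₁ v₂, (ψ d).baseChange Af v₁ v₂ = algebraMap ℚ Af m * s.baseChange Af (α v₁) (α v₂)

/-- The determinant of `α`, computed with respect to rational bases, lies in `ℚ`; that is,
`det α` maps the rational line `⋀²¹ V_{2d}` to the rational line `⋀²¹ W`. -/
def HasRationalDet {W : Type} [AddCommGroup W] [Module ℚ W]
    (α : (Af ⊗[ℚ] V) ≃ₗ[Af] (Af ⊗[ℚ] W)) : Prop :=
  ∃ (u : V ≃ₗ[ℚ] W) (r : ℚ),
    LinearMap.det ((α ≪≫ₗ (bc Af u).symm : (Af ⊗[ℚ] V) ≃ₗ[Af] (Af ⊗[ℚ] V)) :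
      (Af ⊗[ℚ] V) →ₗ[Af] (Af ⊗[ℚ] V)) = algebraMap ℚ Af r

/-- The objects `((W, h), s, αK)`; the field `level` is the orbit `αK`. -/
structure HK (d : ℕ) (K : Subgroup (GAf d)) where
  W : Type
  [addCommGroup : AddCommGroup W]
  [module : Module ℚ W]
  h : Rep W
  s : LinearMap.BilinForm ℚ W
  isPolarizedK3 : IsPolarizedK3 s h
  level : Set ((Af ⊗[ℚ] V) ≃ₗ[Af] (Af ⊗[ℚ] W))
  isLevel : ∃ α : (Af ⊗[ℚ] V) ≃ₗ[Af] (Af ⊗[ℚ] W),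
    (∃ m : ℚ, 0 < m ∧ IsSimilitude d s m α) ∧ HasRationalDet α ∧
    level = {β | ∃ k ∈ K, β = (k : (Af ⊗[ℚ] V) ≃ₗ[Af] (Af ⊗[ℚ] V)) ≪≫ₗ α}

attribute [instance] HK.addCommGroup HK.module

variable {d : ℕ} {K : Subgroup (GAf d)}

/-- Two objects are isomorphic if there is an isomorphism `b` of `ℚ`-Hodge structures with
`s = c · s' ∘ (b × b)` for some `c ∈ ℚˣ` and `b ∘ α ≡ α' (mod K)`. -/
def HK.Iso (X Y : HK d K) : Prop :=
  ∃ b : X.W ≃ₗ[ℚ] Y.W, transport b X.h = Y.h ∧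
    (∃ c : ℚ, c ≠ 0 ∧ ∀ x y, X.s x y = c * Y.s (b x) (b y)) ∧
    ∃ α ∈ X.level, α ≪≫ₗ bc Af b ∈ Y.level

theorem HK.level_mem (X : HK d K) {α β : (Af ⊗[ℚ] V) ≃ₗ[Af] (Af ⊗[ℚ] X.W)}
    (hα : α ∈ X.level) :
    β ∈ X.level ↔ ∃ k ∈ K, β = (k : (Af ⊗[ℚ] V) ≃ₗ[Af] (Af ⊗[ℚ] V)) ≪≫ₗ α := by
  obtain ⟨α₀, -, -, hl⟩ := X.isLevel
  rw [hl] at hα ⊢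
  obtain ⟨k, hk, rfl⟩ := hα
  constructor
  · rintro ⟨k', hk', rfl⟩
    refine ⟨k⁻¹ * k', mul_mem (inv_mem hk) hk', ?_⟩
    ext x
    simp [← LinearEquiv.mul_apply]
  · rintro ⟨k', hk', rfl⟩
    exact ⟨k * k', mul_mem hk hk', rfl⟩

theorem HK.level_nonempty (X : HK d K) : ∃ α, α ∈ X.level := by
  obtain ⟨α₀, -, -, hl⟩ := X.isLevel
  exact ⟨α₀, by rw [hl]; exact ⟨1, one_mem _, rfl⟩⟩

/-- Isomorphism in `HK` is an equivalence relation. -/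
instance HK.setoid (d : ℕ) (K : Subgroup (GAf d)) : Setoid (HK d K) where
  r := HK.Iso
  iseqv := by
    refine ⟨fun X => ?_, ?_, ?_⟩
    · obtain ⟨α, hα⟩ := X.level_nonempty
      refine ⟨LinearEquiv.refl ℚ X.W, transport_refl _, ⟨1, one_ne_zero, by simp⟩, α, hα, ?_⟩
      rwa [bc_refl, LinearEquiv.trans_refl]
    · rintro X Y ⟨b, hb, ⟨c, hc, hs⟩, α, hα, hα'⟩
      refine ⟨b.symm, transport_symm hb, ⟨c⁻¹, inv_ne_zero hc, fun x y => ?_⟩, _, hα', ?_⟩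
      · simp [hs, hc]
      · rwa [bc_symm, LinearEquiv.trans_assoc, LinearEquiv.self_trans_symm,
          LinearEquiv.trans_refl]
    · rintro X Y Z ⟨b, hb, ⟨c, hc, hs⟩, α, hα, hα'⟩ ⟨b', hb', ⟨c', hc', hs'⟩, β, hβ, hβ'⟩
      refine ⟨b ≪≫ₗ b', by rw [transport_trans, hb, hb'],
        ⟨c * c', mul_ne_zero hc hc', fun x y => by simp [hs, hs', mul_assoc]⟩, α, hα, ?_⟩
      obtain ⟨k, hk, e⟩ := (Y.level_mem hβ).1 hα'
      rw [bc_trans, ← LinearEquiv.trans_assoc, e, LinearEquiv.trans_assoc]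
      exact (Z.level_mem hβ').2 ⟨k, hk, rfl⟩

/-- The choices that enter the period point of `((W, h), s, αK)`: a representative `α` of the
orbit, its factor `m_s`, and an isomorphism `a : W → V_{2d}` with
`s = m_s⁻¹ · ψ_{2d} ∘ (a × a)` and `a ∘ α ∈ G(𝔸_f)`. -/
structure HK.Marking (X : HK d K) where
  α : (Af ⊗[ℚ] V) ≃ₗ[Af] (Af ⊗[ℚ] X.W)
  α_mem : α ∈ X.level
  m : ℚ
  m_pos : 0 < m
  similitude : IsSimilitude d X.s m α
  a : X.W ≃ₗ[ℚ] V
  form_eq : ∀ x y, X.s x y = m⁻¹ * ψ d (a x) (a y)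
  comp_mem : α ≪≫ₗ bc Af a ∈ GAf d

end K3Shimura

end

open scoped TensorProduct

noncomputable section

namespace K3Shimura

/-! ### Rational similitudes between the spaces `V_{2d}` -/

/-- The simple roots of `E₈` in the standard coordinates of `ℚ⁸`, as columns. -/
def rootsE₈ : Matrix (Fin 8) (Fin 8) ℚ :=
  !![1/2, 1, -1, 0, 0, 0, 0, 0;
    -1/2, 1, 1, -1, 0, 0, 0, 0;
    -1/2, 0, 0, 1, -1, 0, 0, 0;
    -1/2, 0, 0, 0, 1, -1, 0, 0;
    -1/2, 0, 0, 0, 0, 1, -1, 0;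
    -1/2, 0, 0, 0, 0, 0, 1, -1;
    -1/2, 0, 0, 0, 0, 0, 0, 1;
    1/2, 0, 0, 0, 0, 0, 0, 0]

theorem transpose_rootsE₈_mul :
    rootsE₈.transpose * rootsE₈ = CartanMatrix.E₈.map (Int.cast : ℤ → ℚ) := by
  ext i j
  fin_cases i <;> fin_cases j <;>
    simp [rootsE₈, CartanMatrix.E₈, Matrix.mul_apply, Fin.sum_univ_eight] <;> norm_num

theorem det_map_intCast {n : Type*} [Fintype n] [DecidableEq n] (A : Matrix n n ℤ) :
    (A.map (Int.cast : ℤ → ℚ)).det = (A.det : ℚ) :=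
  (Int.cast_det A).symm

theorem isUnit_rootsE₈_det : IsUnit rootsE₈.det := by
  have h := congrArg Matrix.det transpose_rootsE₈_mul
  rw [Matrix.det_mul, Matrix.det_transpose, det_map_intCast, CartanMatrix.E₈_det,
    Int.cast_one] at h
  exact IsUnit.of_mul_eq_one _ h

theorem exists_sum_four_squares {m : ℚ} (hm : 0 < m) :
    ∃ a b c d : ℚ, a ^ 2 + b ^ 2 + c ^ 2 + d ^ 2 = m := by
  -- Since `m = (num · den) / den²`, Lagrange's theorem for the integer `num · den` suffices.
  obtain ⟨a, b, c, d, h⟩ := Nat.sum_four_squares (m.num.toNat * m.den)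
  have hnum : (m.num.toNat : ℚ) = m.num := by
    exact_mod_cast Int.toNat_of_nonneg (Rat.num_pos.2 hm).le
  have hden : (m.den : ℚ) ≠ 0 := by exact_mod_cast m.den_nz
  have h' : (a : ℚ) ^ 2 + b ^ 2 + c ^ 2 + d ^ 2 = m.num * m.den := by
    rw [← hnum]; exact_mod_cast h
  refine ⟨a / m.den, b / m.den, c / m.den, d / m.den, ?_⟩
  have : (a / m.den : ℚ) ^ 2 + (b / m.den) ^ 2 + (c / m.den) ^ 2 + (d / m.den) ^ 2 =
      m.num * m.den / m.den ^ 2 := by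
    rw [← h']; ring
  rw [this, pow_two, mul_div_mul_right _ _ hden, Rat.num_div_den]

/-- Multiplication by a quaternion is a similitude of the sum of four squares. -/
theorem exists_similitude_fin_four {m : ℚ} (hm : 0 < m) :
    ∃ S : Matrix (Fin 4) (Fin 4) ℚ, S.transpose * S = m • 1 := by
  obtain ⟨a, b, c, d, rfl⟩ := exists_sum_four_squares hm
  refine ⟨!![a, -b, -c, -d; b, a, -d, c; c, d, a, -b; d, -c, b, a], ?_⟩
  ext i j
  fin_cases i <;> fin_cases j <;>
    simp [Matrix.mul_apply, Fin.sum_univ_four] <;> ring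

theorem exists_similitude_fin_eight {m : ℚ} (hm : 0 < m) :
    ∃ S : Matrix (Fin 8) (Fin 8) ℚ, S.transpose * S = m • 1 := by
  obtain ⟨S, hS⟩ := exists_similitude_fin_four hm
  let e : Fin 4 ⊕ Fin 4 ≃ Fin 8 := finSumFinEquiv
  refine ⟨Matrix.reindex e e (Matrix.fromBlocks S 0 0 S), ?_⟩
  rw [Matrix.transpose_reindex, Matrix.reindex_apply, Matrix.reindex_apply,
    Matrix.submatrix_mul_equiv, Matrix.fromBlocks_transpose, Matrix.fromBlocks_multiply]
  simp only [Matrix.transpose_zero, zero_mul, mul_zero, add_zero, zero_add, hS]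
  rw [← smul_zero m (A := Matrix (Fin 4) (Fin 4) ℚ), ← Matrix.fromBlocks_smul,
    Matrix.fromBlocks_one]
  ext i j
  simp [Matrix.one_apply]

/-- `rootsE₈` is a rational isometry from the `E₈` form to the sum of eight squares, so a similitude
of the latter is conjugated back. -/
theorem exists_similitude_E₈ {m : ℚ} (hm : 0 < m) :
    ∃ T : Matrix (Fin 8) (Fin 8) ℚ,
      T.transpose * CartanMatrix.E₈.map (Int.cast : ℤ → ℚ) * T =
        m • CartanMatrix.E₈.map (Int.cast : ℤ → ℚ) := by
  obtain ⟨S, hS⟩ := exists_similitude_fin_eight hm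
  refine ⟨rootsE₈⁻¹ * S * rootsE₈, ?_⟩
  have h1 : rootsE₈ * rootsE₈⁻¹ = 1 := Matrix.mul_nonsing_inv _ isUnit_rootsE₈_det
  have h2 : rootsE₈ * (rootsE₈⁻¹ * S * rootsE₈) = S * rootsE₈ := by
    rw [Matrix.mul_assoc, ← Matrix.mul_assoc, h1, Matrix.one_mul]
  generalize rootsE₈⁻¹ * S * rootsE₈ = T at h2 ⊢
  rw [← transpose_rootsE₈_mul, Matrix.mul_assoc, Matrix.mul_assoc, h2, ← Matrix.mul_assoc,
    ← Matrix.transpose_mul, h2, Matrix.transpose_mul, Matrix.mul_assoc,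
    ← Matrix.mul_assoc S.transpose, hS, Matrix.smul_mul, Matrix.one_mul, Matrix.mul_smul]

theorem exists_similitude_gramU (m : ℚ) :
    ∃ T : Matrix (Fin 2) (Fin 2) ℚ,
      T.transpose * gramU.map (Int.cast : ℤ → ℚ) * T = m • gramU.map (Int.cast : ℤ → ℚ) := by
  refine ⟨!![m, 0; 0, 1], ?_⟩
  ext i j
  fin_cases i <;> fin_cases j <;> simp [gramU, Matrix.mul_apply, Fin.sum_univ_two]

theorem gram_map (d : ℕ) : (gram d).map (Int.cast : ℤ → ℚ) =
    Matrix.fromBlocks !![2 * (d : ℚ)] 0 0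
      (Matrix.fromBlocks
        (Matrix.fromBlocks (gramU.map Int.cast) 0 0 (gramU.map Int.cast)) 0 0
        (Matrix.fromBlocks (CartanMatrix.E₈.map Int.cast) 0 0
          (CartanMatrix.E₈.map Int.cast))) := by
  have h : (!![2 * (d : ℤ)]).map (Int.cast : ℤ → ℚ) = !![2 * (d : ℚ)] := by
    ext i j
    simp
  simp [gram, Matrix.fromBlocks_map, h]

/-- If `d = m e ρ²` then `V_{2e}` and `V_{2d}` are similar with factor `m`. -/
theorem exists_similitude_gram {d e : ℕ} {m ρ : ℚ} (hm : 0 < m) (h : (d : ℚ) = m * e * ρ ^ 2) :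
    ∃ T : Matrix Idx Idx ℚ, (gram d).map (Int.cast : ℤ → ℚ) =
      m • (T.transpose * (gram e).map (Int.cast : ℤ → ℚ) * T) := by
  -- The `U` and `E₈` blocks do not depend on `d` or `e`, so there `T` must have factor `m⁻¹` to
  -- cancel the outer `m`.
  obtain ⟨A, hA⟩ := exists_similitude_gramU m⁻¹
  obtain ⟨B, hB⟩ := exists_similitude_E₈ (inv_pos.2 hm)
  refine ⟨Matrix.fromBlocks !![ρ] 0 0 (Matrix.fromBlocks (Matrix.fromBlocks A 0 0 A) 0 0
    (Matrix.fromBlocks B 0 0 B)), ?_⟩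
  have h1 : m • ((!![ρ] : Matrix (Fin 1) (Fin 1) ℚ).transpose * !![2 * (e : ℚ)] * !![ρ]) =
      !![2 * (d : ℚ)] := by
    ext i j
    fin_cases i; fin_cases j
    simp [Matrix.mul_apply, h]
    ring
  rw [gram_map, gram_map]
  simp only [Matrix.fromBlocks_transpose, Matrix.fromBlocks_multiply, Matrix.transpose_zero,
    Matrix.zero_mul, Matrix.mul_zero, add_zero, zero_add, hA, hB, Matrix.fromBlocks_smul,
    smul_zero, h1, smul_smul, mul_inv_cancel₀ hm.ne', one_smul]

theorem exists_gram_det : ∃ D : ℚ, D ≠ 0 ∧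
    ∀ d : ℕ, ((gram d).map (Int.cast : ℤ → ℚ)).det = d * D := by
  refine ⟨2, by norm_num, fun d => ?_⟩
  rw [det_map_intCast]
  simp [gram, gramU, Matrix.det_fromBlocks_zero₂₁, CartanMatrix.E₈_det, Matrix.det_fin_two]
  ring

theorem gram_det_ne_zero {d : ℕ} (hd : 0 < d) :
    ((gram d).map (Int.cast : ℤ → ℚ)).det ≠ 0 := by
  obtain ⟨D, hD, h⟩ := exists_gram_det
  rw [h]
  exact mul_ne_zero (by exact_mod_cast hd.ne') hD

theorem exists_linearEquiv_similitude {d e : ℕ} (hd : 0 < d) {m ρ : ℚ} (hm : 0 < m)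
    (h : (d : ℚ) = m * e * ρ ^ 2) :
    ∃ T : V ≃ₗ[ℚ] V, ∀ x y, ψ d x y = m * ψ e (T x) (T y) := by
  obtain ⟨T, hT⟩ := exists_similitude_gram hm h
  -- A singular `T` would make the Gram matrix of `V_{2d}` singular.
  have hdet : IsUnit T.det := by
    rw [isUnit_iff_ne_zero]
    intro h0
    apply gram_det_ne_zero hd
    rw [hT, Matrix.det_smul, Matrix.det_mul, h0, mul_zero, mul_zero]
  refine ⟨Matrix.toLinearEquiv' T ((Matrix.isUnit_iff_isUnit_det _).2 hdet).invertible,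
    fun x y => ?_⟩
  have h1 : ∀ z, Matrix.toLinearEquiv' T ((Matrix.isUnit_iff_isUnit_det _).2 hdet).invertible z
    = T.mulVec z := fun z => rfl
  rw [h1, h1, ψ, ψ, Matrix.toBilin'_apply', Matrix.toBilin'_apply', hT, Matrix.smul_mulVec,
    dotProduct_smul, smul_eq_mul, ← Matrix.mulVec_mulVec, ← Matrix.mulVec_mulVec,
    Matrix.dotProduct_mulVec, Matrix.vecMul_transpose]

/-! ### Determinants of similitudes -/

theorem det_toMatrix_of_similitude {R M ι : Type*} [CommRing R] [AddCommGroup M] [Module R M]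
    [Fintype ι] [DecidableEq ι] (b : Module.Basis ι R M) {B B' : LinearMap.BilinForm R M}
    {g : M →ₗ[R] M} {t : R} (h : ∀ x y, B x y = t * B' (g x) (g y)) :
    (LinearMap.BilinForm.toMatrix b B).det =
      t ^ Fintype.card ι * (LinearMap.det g ^ 2 * (LinearMap.BilinForm.toMatrix b B').det) := by
  have hB : B = t • B'.comp g g := by
    ext x y
    simp [h]
  rw [hB, map_smul, Matrix.det_smul, LinearMap.BilinForm.toMatrix_comp b b, Matrix.det_mul,
    Matrix.det_mul, Matrix.det_transpose, LinearMap.det_toMatrix]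
  ring

theorem toMatrix_baseChange_ψ (R : Type) [CommRing R] [Algebra ℚ R] (d : ℕ) :
    LinearMap.BilinForm.toMatrix (Algebra.TensorProduct.basis R (Pi.basisFun ℚ Idx))
      ((ψ d).baseChange R) =
    ((gram d).map (Int.cast : ℤ → ℚ)).map (algebraMap ℚ R) := by
  ext i j
  rw [LinearMap.BilinForm.toMatrix_apply, Algebra.TensorProduct.basis_apply,
    Algebra.TensorProduct.basis_apply, LinearMap.BilinForm.baseChange_tmul, Pi.basisFun_apply,
    Pi.basisFun_apply, ψ, Matrix.toBilin'_single, mul_one]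
  exact (Algebra.algebraMap_eq_smul_one _).symm

theorem det_toMatrix_baseChange_ψ (R : Type) [CommRing R] [Algebra ℚ R] (d : ℕ) :
    (LinearMap.BilinForm.toMatrix (Algebra.TensorProduct.basis R (Pi.basisFun ℚ Idx))
      ((ψ d).baseChange R)).det =
    algebraMap ℚ R ((gram d).map (Int.cast : ℤ → ℚ)).det := by
  rw [toMatrix_baseChange_ψ, RingHom.map_det, RingHom.mapMatrix_apply]

/-- Makes `ℚ → 𝔸_f` injective, so rational identities can be read off adelically. The component at
the prime 2 separates 0 from 1. -/
instance : Nontrivial Af := by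
  let v : IsDedekindDomain.HeightOneSpectrum ℤ :=
    { asIdeal := Ideal.span {2}
      isPrime := (Ideal.span_singleton_prime two_ne_zero).2 Int.prime_two
      ne_bot := by simp }
  refine ⟨0, 1, fun h => ?_⟩
  have h' := congrArg (fun f : Af => f v) h
  exact zero_ne_one h'

/-- The rational factor relation `d = m²¹ e r²` between the discriminants of similar spaces. -/
theorem discriminant_relation {d e : ℕ} {m r : ℚ}
    {g : (Af ⊗[ℚ] V) →ₗ[Af] (Af ⊗[ℚ] V)}
    (h : ∀ x y, (ψ d).baseChange Af x y =
      algebraMap ℚ Af m * (ψ e).baseChange Af (g x) (g y))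
    (hg : LinearMap.det g = algebraMap ℚ Af r) :
    (d : ℚ) = m ^ 21 * r ^ 2 * e := by
  have := det_toMatrix_of_similitude (Algebra.TensorProduct.basis Af (Pi.basisFun ℚ Idx)) h
  obtain ⟨D, hD, hdet⟩ := exists_gram_det
  rw [det_toMatrix_baseChange_ψ, det_toMatrix_baseChange_ψ, hg, hdet, hdet,
    show Fintype.card Idx = 21 from rfl, ← map_pow, ← map_pow, ← map_mul, ← map_mul] at this
  have := (algebraMap ℚ Af).injective this
  apply mul_right_cancel₀ hD
  linear_combination this

/-! ### Base change of forms and maps -/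

section BaseChange

variable {W W' : Type} [AddCommGroup W] [Module ℚ W] [AddCommGroup W'] [Module ℚ W']

theorem baseChange_similitude (R : Type) [CommRing R] [Algebra ℚ R]
    {s : LinearMap.BilinForm ℚ W} {s' : LinearMap.BilinForm ℚ W'} {b : W ≃ₗ[ℚ] W'} {c : ℚ}
    (h : ∀ x y, s x y = c * s' (b x) (b y)) (x y : R ⊗[ℚ] W) :
    s.baseChange R x y = algebraMap ℚ R c * s'.baseChange R (bc R b x) (bc R b y) := by
  induction x with
  | zero => simp
  | add x₁ x₂ h₁ h₂ => simp only [map_add, LinearMap.add_apply, h₁, h₂, mul_add]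
  | tmul r w =>
    induction y with
    | zero => simp
    | add y₁ y₂ h₁ h₂ => simp only [map_add, h₁, h₂, mul_add]
    | tmul r' w' =>
      rw [LinearEquiv.baseChange_tmul, LinearEquiv.baseChange_tmul,
        LinearMap.BilinForm.baseChange_tmul, LinearMap.BilinForm.baseChange_tmul, h,
        mul_smul, Algebra.smul_def c]

theorem det_bc (R : Type) [CommRing R] [Algebra ℚ R] (q : V ≃ₗ[ℚ] V) :
    LinearMap.det ((bc R q : (R ⊗[ℚ] V) ≃ₗ[R] (R ⊗[ℚ] V)) : (R ⊗[ℚ] V) →ₗ[R] (R ⊗[ℚ] V)) =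
      algebraMap ℚ R (LinearMap.det (q : V →ₗ[ℚ] V)) := by
  rw [← LinearMap.det_baseChange]
  rfl

/-- Both conditions are rational equations, tested on vectors `1 ⊗ x` and descended along the
injection `ℚ → 𝔸_f`. -/
theorem mem_GQ_of_bc_mem {d : ℕ} {q : V ≃ₗ[ℚ] V} (h : bc Af q ∈ GAf d) : q ∈ GQ d := by
  refine ⟨fun x y => ?_, ?_⟩
  · have h1 := h.1 (1 ⊗ₜ x) (1 ⊗ₜ y)
    rw [LinearEquiv.baseChange_tmul, LinearEquiv.baseChange_tmul,
      LinearMap.BilinForm.baseChange_tmul, LinearMap.BilinForm.baseChange_tmul, mul_one,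
      ← Algebra.algebraMap_eq_smul_one, ← Algebra.algebraMap_eq_smul_one] at h1
    exact (algebraMap ℚ Af).injective h1
  · have h2 := h.2
    rw [det_bc] at h2
    exact (algebraMap ℚ Af).injective (h2.trans (map_one _).symm)

/-! ### Transport of Hodge structures -/

theorem transport_apply (a : W ≃ₗ[ℚ] W') (h : Rep W) (z : ℂˣ) (x : ℝ ⊗[ℚ] W) :
    transport a h z (bc ℝ a x) = bc ℝ a (h z x) := by
  simp [transport]

theorem transport_mem_SO {s : LinearMap.BilinForm ℚ W} {s' : LinearMap.BilinForm ℚ W'}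
    {a : W ≃ₗ[ℚ] W'} {c : ℚ} (hc : c ≠ 0) (hs : ∀ x y, s x y = c * s' (a x) (a y))
    {h : Rep W} (hh : ∀ z, h z ∈ SO (s.baseChange ℝ)) (z : ℂˣ) :
    transport a h z ∈ SO (s'.baseChange ℝ) := by
  refine ⟨fun x y => ?_, ?_⟩
  · obtain ⟨x, rfl⟩ := (bc ℝ a).surjective x
    obtain ⟨y, rfl⟩ := (bc ℝ a).surjective y
    have h1 := (hh z).1 x y
    rw [baseChange_similitude ℝ hs, baseChange_similitude ℝ hs x y] at h1
    rw [transport_apply, transport_apply]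
    exact mul_left_cancel₀ (by simpa using hc) h1
  · rw [← (hh z).2, ← LinearMap.det_conj _ (bc ℝ a)]
    rfl

/-- Positivity of `c` matters here: a negative factor would exchange polarizations of `s'` and
`-s'`. -/
theorem isPolarization_transport {s : LinearMap.BilinForm ℚ W} {s' : LinearMap.BilinForm ℚ W'}
    {a : W ≃ₗ[ℚ] W'} {c : ℚ} (hc : 0 < c) (hs : ∀ x y, s x y = c * s' (a x) (a y))
    {h : Rep W} (hh : IsPolarization s h) : IsPolarization s' (transport a h) := by
  have hc' : (0 : ℝ) < algebraMap ℚ ℝ c := by simpa using hc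
  refine ⟨fun z x y => ?_, fun x y => ?_, fun x hx => ?_⟩
  all_goals obtain ⟨x, rfl⟩ := (bc ℝ a).surjective x
  · obtain ⟨y, rfl⟩ := (bc ℝ a).surjective y
    have h1 := hh.invariant z x y
    rw [baseChange_similitude ℝ hs, baseChange_similitude ℝ hs x y] at h1
    rw [transport_apply, transport_apply]
    exact mul_left_cancel₀ hc'.ne' h1
  · obtain ⟨y, rfl⟩ := (bc ℝ a).surjective y
    have h1 := hh.symm x y
    rw [baseChange_similitude ℝ hs, baseChange_similitude ℝ hs y] at h1
    rw [transport_apply, transport_apply]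
    exact mul_left_cancel₀ hc'.ne' h1
  · have h1 := hh.pos x (by rintro rfl; simp at hx)
    rw [baseChange_similitude ℝ hs] at h1
    rw [transport_apply]
    exact (mul_pos_iff_of_pos_left hc').1 h1

/-- The complexification of `a` intertwines the two actions, so it carries simultaneous eigenspaces
to simultaneous eigenspaces. -/
theorem hodgePiece_transport (a : W ≃ₗ[ℚ] W') (h : Rep W) (p q : ℤ) :
    hodgePiece (transport a h) p q =
      (hodgePiece h p q).map (LinearEquiv.baseChange ℝ ℂ _ _ (bc ℝ a)).toLinearMap := by
  let E := LinearEquiv.baseChange ℝ ℂ _ _ (bc ℝ a)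
  have hE : ∀ (z : ℂˣ) (x : ℂ ⊗[ℝ] (ℝ ⊗[ℚ] W)),
      ((transport a h z : (ℝ ⊗[ℚ] W') ≃ₗ[ℝ] (ℝ ⊗[ℚ] W')) :
        (ℝ ⊗[ℚ] W') →ₗ[ℝ] (ℝ ⊗[ℚ] W')).baseChange ℂ (E x) =
      E (((h z : (ℝ ⊗[ℚ] W) ≃ₗ[ℝ] (ℝ ⊗[ℚ] W)) :
        (ℝ ⊗[ℚ] W) →ₗ[ℝ] (ℝ ⊗[ℚ] W)).baseChange ℂ x) := by
    intro z x
    induction x with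
    | zero => simp
    | add x y hx hy => simp only [map_add, hx, hy]
    | tmul r w =>
      simp only [E, LinearEquiv.baseChange_tmul, LinearMap.baseChange_tmul,
        LinearEquiv.coe_coe, transport_apply]
  ext y
  obtain ⟨x, rfl⟩ := E.surjective y
  have hmem : E x ∈ (hodgePiece h p q).map E.toLinearMap ↔ x ∈ hodgePiece h p q :=
    E.injective.mem_set_image
  refine Iff.trans ?_ hmem.symm
  simp only [hodgePiece, Submodule.mem_iInf, Module.End.mem_eigenspace_iff, hE, ← map_smul,
    E.injective.eq_iff]

theorem isK3HodgeStructure_transport (a : W ≃ₗ[ℚ] W') {h : Rep W} (hh : IsK3HodgeStructure h) :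
    IsK3HodgeStructure (transport a h) := by
  refine ⟨?_, ?_, ?_, ?_⟩
  · simp only [hodgePiece_transport, ← Submodule.map_sup, hh.type_eq, Submodule.map_top,
      LinearEquiv.range]
  · rw [hodgePiece_transport, LinearEquiv.finrank_map_eq, hh.finrank_neg]
  · rw [hodgePiece_transport, LinearEquiv.finrank_map_eq, hh.finrank_zero]
  · rw [hodgePiece_transport, LinearEquiv.finrank_map_eq, hh.finrank_pos]

end BaseChange

/-! ### The sign of the polarization -/

/-- The range of a real endomorphism has dimension at most the codimension of any complex subspace
on which the complexified endomorphism vanishes. -/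
theorem finrank_range_add_le {M : Type*} [AddCommGroup M] [Module ℝ M] [FiniteDimensional ℝ M]
    (N : M →ₗ[ℝ] M) (P : Submodule ℂ (ℂ ⊗[ℝ] M)) (hP : ∀ x ∈ P, N.baseChange ℂ x = 0) :
    Module.finrank ℝ (LinearMap.range N) + Module.finrank ℂ P ≤ Module.finrank ℝ M := by
  -- `N` factors through its real range. After complexification the first factor stays onto and, by
  -- flatness, the second stays injective, so `P` lies in the kernel of the first and rank-nullity
  -- applies.
  have hsurj : Function.Surjective (N.rangeRestrict.baseChange ℂ) :=
    LinearMap.lTensor_surjective ℂ N.surjective_rangeRestrict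
  have hinj : Function.Injective ((LinearMap.range N).subtype.baseChange ℂ) :=
    Module.Flat.lTensor_preserves_injective_linearMap _ (Submodule.injective_subtype _)
  have hle : P ≤ LinearMap.ker (N.rangeRestrict.baseChange ℂ) := by
    intro x hx
    apply hinj
    rw [map_zero, ← LinearMap.comp_apply, ← LinearMap.baseChange_comp]
    exact hP x hx
  have h1 := LinearMap.finrank_range_add_finrank_ker (N.rangeRestrict.baseChange ℂ)
  rw [LinearMap.range_eq_top.2 hsurj, finrank_top, Module.finrank_baseChange,
    Module.finrank_baseChange] at h1
  have h2 := Submodule.finrank_mono hle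
  omega

/-- Three pairwise orthogonal vectors of positive length in `V_{2d}`. -/
def positiveVectors : Fin 3 → V :=
  ![Pi.single (Sum.inl 0) 1,
    Pi.single (Sum.inr (Sum.inl (Sum.inl 0))) 1 + Pi.single (Sum.inr (Sum.inl (Sum.inl 1))) 1,
    Pi.single (Sum.inr (Sum.inl (Sum.inr 0))) 1 + Pi.single (Sum.inr (Sum.inl (Sum.inr 1))) 1]

theorem ψ_positiveVectors (d : ℕ) (i j : Fin 3) :
    ψ d (positiveVectors i) (positiveVectors j) =
      Matrix.diagonal ![2 * (d : ℚ), 2, 2] i j := by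
  fin_cases i <;> fin_cases j <;>
    simp [positiveVectors, ψ, Matrix.toBilin'_single, gram, gramU] <;>
    norm_num

/-- A nonzero vector fixed by `h(i)` in the span of the positive vectors would have both `ψ > 0` and
`-ψ > 0`. -/
theorem not_isPolarization_neg {d : ℕ} (hd : 0 < d) {h : Rep V} (hh : IsK3HodgeStructure h) :
    ¬ IsPolarization (-ψ d) h := by
  intro hpol
  let J : (ℝ ⊗[ℚ] V) →ₗ[ℝ] (ℝ ⊗[ℚ] V) := (h unitI : (ℝ ⊗[ℚ] V) ≃ₗ[ℝ] (ℝ ⊗[ℚ] V))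
  have hrank := finrank_range_add_le (J - LinearMap.id) (hodgePiece h 0 0) (by
    intro x hx
    have h1 := Module.End.mem_eigenspace_iff.1 ((Submodule.mem_iInf _).1 hx unitI)
    simp only [neg_zero, zpow_zero, mul_one, one_smul] at h1
    rw [LinearMap.baseChange_sub, LinearMap.sub_apply, LinearMap.baseChange_id,
      LinearMap.id_apply, sub_eq_zero]
    exact h1)
  rw [hh.finrank_zero, Module.finrank_baseChange, Module.finrank_fintype_fun_eq_card,
    show Fintype.card Idx = 21 from rfl] at hrank
  let p : (Fin 3 → ℝ) →ₗ[ℝ] (ℝ ⊗[ℚ] V) :=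
    Fintype.linearCombination ℝ (fun i => (1 : ℝ) ⊗ₜ[ℚ] positiveVectors i)
  have hform : ∀ c, (ψ d).baseChange ℝ (p c) (p c) =
      2 * d * c 0 ^ 2 + 2 * c 1 ^ 2 + 2 * c 2 ^ 2 := by
    intro c
    simp only [p, Fintype.linearCombination_apply, Fin.sum_univ_three]
    simp [ψ_positiveVectors]
    ring
  -- `h(i)` is the identity on the 19-dimensional `(0,0)` piece, so `J - 1` has rank at most `21 -
  -- 19 = 2` and kills a nonzero vector of the 3-space.
  have hker : LinearMap.ker ((J - LinearMap.id).rangeRestrict ∘ₗ p) ≠ ⊥ :=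
    LinearMap.ker_ne_bot_of_finrank_lt (by rw [Module.finrank_fin_fun]; omega)
  obtain ⟨c, hc, hc0⟩ := Submodule.exists_mem_ne_zero_of_ne_bot hker
  have hfix : J (p c) = p c := sub_eq_zero.1 (congrArg Subtype.val (LinearMap.mem_ker.1 hc))
  have hpos : 0 < (ψ d).baseChange ℝ (p c) (p c) := by
    rw [hform]
    have hd' : (0 : ℝ) < d := by exact_mod_cast hd
    obtain ⟨i, hi⟩ := Function.ne_iff.1 hc0
    have : 0 < c i ^ 2 := sq_pos_of_ne_zero hi
    have h0 : 0 ≤ d * c 0 ^ 2 := by positivity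
    fin_cases i
    · have : 0 < d * c 0 ^ 2 := mul_pos hd' this
      nlinarith [sq_nonneg (c 1), sq_nonneg (c 2)]
    · change 0 < c 1 ^ 2 at this
      nlinarith [sq_nonneg (c 2)]
    · change 0 < c 2 ^ 2 at this
      nlinarith [sq_nonneg (c 1)]
  have hneg := hpol.pos (p c) (by intro h0; rw [h0] at hpos; simp at hpos)
  have hbc := baseChange_similitude ℝ (s := -ψ d) (s' := ψ d) (b := LinearEquiv.refl ℚ V)
    (c := -1) (fun x y => by simp) (p c) (p c)
  change 0 < (-ψ d).baseChange ℝ (p c) (J (p c)) at hneg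
  rw [hfix, hbc, bc_refl, LinearEquiv.refl_apply, map_neg, map_one] at hneg
  linarith

variable {d : ℕ} {K : Subgroup (GAf d)}

/-! ### Markings -/

/-- Replacing `u⁻¹` by `a` only multiplies the determinant by that of the rational automorphism `a ∘
u`. -/
theorem HasRationalDet.exists_det_eq {W : Type} [AddCommGroup W] [Module ℚ W]
    {α : (Af ⊗[ℚ] V) ≃ₗ[Af] (Af ⊗[ℚ] W)} (hα : HasRationalDet α) (a : W ≃ₗ[ℚ] V) :
    ∃ r : ℚ, LinearMap.det ((α ≪≫ₗ bc Af a : (Af ⊗[ℚ] V) ≃ₗ[Af] (Af ⊗[ℚ] V)) :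
      (Af ⊗[ℚ] V) →ₗ[Af] (Af ⊗[ℚ] V)) = algebraMap ℚ Af r := by
  obtain ⟨u, r, hr⟩ := hα
  refine ⟨LinearMap.det ((u ≪≫ₗ a : V ≃ₗ[ℚ] V) : V →ₗ[ℚ] V) * r, ?_⟩
  rw [map_mul, ← hr, ← det_bc, ← LinearMap.det_comp]
  congr 1
  ext x
  simp [bc_trans]

/-- Rationality of the determinant is used twice: it turns the adelic discriminant identity into a
rational one, and it forces one common sign at all primes, which a single global `-1` can correct.
-/
theorem exists_rescaled_isometry {W : Type} [AddCommGroup W] [Module ℚ W] (hd : 0 < d) {e : ℕ}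
    {s : LinearMap.BilinForm ℚ W} (u : W ≃ₗ[ℚ] V) (hu : ∀ x y, ψ e (u x) (u y) = s x y)
    {m : ℚ} (hm : 0 < m) {α : (Af ⊗[ℚ] V) ≃ₗ[Af] (Af ⊗[ℚ] W)} (hα : IsSimilitude d s m α)
    (hdet : HasRationalDet α) :
    ∃ a : W ≃ₗ[ℚ] V, (∀ x y, s x y = m⁻¹ * ψ d (a x) (a y)) ∧ α ≪≫ₗ bc Af a ∈ GAf d := by
  obtain ⟨r, hr⟩ := hdet.exists_det_eq u
  have hdisc : (d : ℚ) = m ^ 21 * r ^ 2 * e := by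
    refine discriminant_relation (fun x y => ?_) hr
    rw [hα, baseChange_similitude Af (s := s) (s' := ψ e) (b := u) (c := 1)
      (fun x y => by rw [hu, one_mul]), map_one, one_mul]
    rfl
  -- `m²¹ r² = m · (m¹⁰ r)²`: the odd rank leaves exactly one factor `m` outside the square.
  obtain ⟨T, hT⟩ := exists_linearEquiv_similitude (ρ := m ^ 10 * r) hd hm
    (hdisc.trans (by ring))
  let a : W ≃ₗ[ℚ] V := u ≪≫ₗ T.symm
  have ha : ∀ x y, s x y = m⁻¹ * ψ d (a x) (a y) := by
    intro x y
    rw [hT, inv_mul_cancel_left₀ hm.ne', ← hu]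
    simp [a]
  have hiso : ∀ a' : W ≃ₗ[ℚ] V, (∀ x y, s x y = m⁻¹ * ψ d (a' x) (a' y)) → ∀ x y,
      (ψ d).baseChange Af ((α ≪≫ₗ bc Af a') x) ((α ≪≫ₗ bc Af a') y) =
        (ψ d).baseChange Af x y := by
    intro a' ha' x y
    rw [hα x y, baseChange_similitude Af ha', ← mul_assoc, ← map_mul, mul_inv_cancel₀ hm.ne',
      map_one, one_mul]
    rfl
  obtain ⟨t, ht⟩ := hdet.exists_det_eq a
  -- The same relation with `e = d` and factor 1 gives `t² = 1`.
  have hsq : (d : ℚ) = 1 ^ 21 * t ^ 2 * d := by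
    refine discriminant_relation (fun x y => ?_) ht
    rw [map_one, one_mul]
    exact (hiso a ha x y).symm
  have hd' : (d : ℚ) ≠ 0 := by exact_mod_cast hd.ne'
  have ht2 : t ^ 2 = 1 := mul_right_cancel₀ hd' (by linear_combination -hsq)
  rcases eq_or_eq_neg_of_sq_eq_sq t 1 (ht2.trans (one_pow 2).symm) with rfl | rfl
  · exact ⟨a, ha, hiso a ha, by rw [ht, map_one]⟩
  · have ha' : ∀ x y, s x y =
        m⁻¹ * ψ d ((a ≪≫ₗ LinearEquiv.neg ℚ) x) ((a ≪≫ₗ LinearEquiv.neg ℚ) y) := by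
      intro x y
      rw [ha]
      simp
    refine ⟨a ≪≫ₗ LinearEquiv.neg ℚ, ha', hiso _ ha', ?_⟩
    have hneg : LinearMap.det ((LinearEquiv.neg ℚ : V ≃ₗ[ℚ] V) : V →ₗ[ℚ] V) = -1 := by
      have : ((LinearEquiv.neg ℚ : V ≃ₗ[ℚ] V) : V →ₗ[ℚ] V) = (-1 : ℚ) • LinearMap.id := by
        ext; simp
      rw [this, LinearMap.det_smul, LinearMap.det_id, Module.finrank_fintype_fun_eq_card,
        show Fintype.card Idx = 21 from rfl]
      norm_num
    rw [bc_trans, ← LinearEquiv.trans_assoc, LinearEquiv.coe_trans, LinearMap.det_comp, ht,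
      det_bc, hneg, ← map_mul]
    norm_num

/-- Elements of `K` are isometries of determinant 1, so every representative has the same factor and
the same determinant as the given one. -/
theorem HK.exists_marking (hd : 0 < d) (X : HK d K) {α : (Af ⊗[ℚ] V) ≃ₗ[Af] (Af ⊗[ℚ] X.W)}
    (hα : α ∈ X.level) : ∃ M : X.Marking, M.α = α := by
  obtain ⟨β, ⟨m, hm, hβ⟩, ⟨u, r, hr⟩, hl⟩ := X.isLevel
  obtain ⟨e, -, he⟩ := X.isPolarizedK3
  obtain ⟨w, hw⟩ := he.equivalent
  have hα' := hα
  rw [hl] at hα'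
  obtain ⟨k, -, rfl⟩ := hα'
  have hsim : IsSimilitude d X.s m
      ((k : (Af ⊗[ℚ] V) ≃ₗ[Af] (Af ⊗[ℚ] V)) ≪≫ₗ β) := fun x y => by
    rw [← k.2.1 x y, hβ]
    rfl
  have hdet : HasRationalDet ((k : (Af ⊗[ℚ] V) ≃ₗ[Af] (Af ⊗[ℚ] V)) ≪≫ₗ β) := by
    refine ⟨u, r, ?_⟩
    rw [LinearEquiv.trans_assoc, LinearEquiv.coe_trans, LinearMap.det_comp, hr, k.2.2, mul_one]
  obtain ⟨a, ha, haG⟩ := exists_rescaled_isometry hd w hw hm hsim hdet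
  exact ⟨⟨_, hα, m, hm, hsim, a, ha, haG⟩, rfl⟩

/-! ### Period points and isomorphism classes -/

theorem HK.Marking.transport_mem_Ω {X : HK d K} (M : X.Marking) : transport M.a X.h ∈ Ω d := by
  obtain ⟨e, -, he⟩ := X.isPolarizedK3
  have hm := inv_pos.2 M.m_pos
  exact ⟨transport_mem_SO hm.ne' M.form_eq he.mem_SO, isK3HodgeStructure_transport _ he.hodge,
    Or.inl (isPolarization_transport hm M.form_eq he.polarization)⟩

/-- The period point `[a · h, a ∘ α]_K`. -/
def HK.Marking.point {X : HK d K} (M : X.Marking) : Sh d K :=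
  Sh.mk K ⟨transport M.a X.h, M.transport_mem_Ω⟩ ⟨M.α ≪≫ₗ bc Af M.a, M.comp_mem⟩

/-- Taking `X = Y` and the identity also gives independence of the choice of `a`, `α` and `m`. -/
theorem HK.Marking.point_eq_of_iso {X Y : HK d K} (h : X.Iso Y) (M : X.Marking)
    (N : Y.Marking) : M.point = N.point := by
  obtain ⟨b, hb, -, α, hα, hαb⟩ := h
  obtain ⟨k₁, hk₁, e₁⟩ := (X.level_mem M.α_mem).1 hα
  obtain ⟨k₂, hk₂, e₂⟩ := (Y.level_mem hαb).1 N.α_mem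
  let q : V ≃ₗ[ℚ] V := M.a.symm ≪≫ₗ b ≪≫ₗ N.a
  have hNα : N.α ≪≫ₗ bc Af N.a =
      bc Af q * (M.α ≪≫ₗ bc Af M.a) * (k₁ * k₂ : GAf d) := by
    rw [e₂, e₁]
    ext x
    simp [q, bc_trans, bc_symm]
  refine Quotient.sound ⟨q, mem_GQ_of_bc_mem ?_, k₁ * k₂, mul_mem hk₁ hk₂, ?_, hNα⟩
  -- Adelically `q` is a quotient of elements of `G(𝔸_f)`, which places it in `G(ℚ)`.
  · have : bc Af q = (N.α ≪≫ₗ bc Af N.a) * (k₁ * k₂ : GAf d).1⁻¹ *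
        (M.α ≪≫ₗ bc Af M.a : (Af ⊗[ℚ] V) ≃ₗ[Af] (Af ⊗[ℚ] V))⁻¹ := by
      rw [hNα, mul_inv_cancel_right, mul_inv_cancel_right]
    rw [this]
    exact mul_mem (mul_mem N.comp_mem (inv_mem (k₁ * k₂).2)) (inv_mem M.comp_mem)
  · change transport N.a Y.h = transport q (transport M.a X.h)
    rw [← transport_trans, ← hb, ← transport_trans]
    congr 1
    ext x
    simp [q]

/-- The map `N.a⁻¹ ∘ q ∘ M.a` is the isomorphism. The two markings may have different factors, which
is why forms are compared only up to the scalar `M.m⁻¹ * N.m`. -/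
theorem HK.Marking.iso_of_point_eq {X Y : HK d K} (M : X.Marking) (N : Y.Marking)
    (h : M.point = N.point) : X.Iso Y := by
  obtain ⟨q, hq, k, hk, h1, h2⟩ := Quotient.exact h
  change transport N.a Y.h = transport q (transport M.a X.h) at h1
  change N.α ≪≫ₗ bc Af N.a = bc Af q * (M.α ≪≫ₗ bc Af M.a) * k at h2
  refine ⟨M.a ≪≫ₗ q ≪≫ₗ N.a.symm, ?_, ⟨M.m⁻¹ * N.m, mul_ne_zero (inv_ne_zero M.m_pos.ne')
    N.m_pos.ne', fun x y => ?_⟩, M.α, M.α_mem, ?_⟩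
  · rw [transport_trans, transport_trans, ← h1, ← transport_trans, LinearEquiv.self_trans_symm,
      transport_refl]
  · rw [M.form_eq, N.form_eq, mul_assoc, mul_inv_cancel_left₀ N.m_pos.ne']
    simp [hq.1]
  · refine (Y.level_mem N.α_mem).2 ⟨k⁻¹, inv_mem hk, ?_⟩
    ext x
    -- Evaluating at `k⁻¹ x` moves `k` to the other side.
    have h3 := LinearEquiv.congr_fun h2 ((k⁻¹ : GAf d).1 x)
    apply (bc Af N.a).injective
    refine Eq.trans ?_ h3.symm
    have hk' : (k : (Af ⊗[ℚ] V) ≃ₗ[Af] (Af ⊗[ℚ] V)) ((k⁻¹ : GAf d).1 x) = x :=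
      LinearEquiv.congr_fun (congrArg Subtype.val (mul_inv_cancel k)) x
    simp only [LinearEquiv.mul_apply, hk']
    simp [bc_trans, bc_symm]

/-! ### The period map and its bijectivity -/

theorem trans_bc_refl (g : (Af ⊗[ℚ] V) ≃ₗ[Af] (Af ⊗[ℚ] V)) :
    g ≪≫ₗ bc Af (LinearEquiv.refl ℚ V) = g := by
  rw [bc_refl, LinearEquiv.trans_refl]

/-- The object `((V_{2d}, x), ψ_{2d}, gK)`. -/
def HK.ofPoint (hd : 0 < d) (K : Subgroup (GAf d)) (x : Ω d) (g : GAf d)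
    (hx : IsPolarizedK3OfDegree d (ψ d) (x : Rep V)) : HK d K where
  W := V
  h := x
  s := ψ d
  isPolarizedK3 := ⟨d, hd, hx⟩
  level := {β | ∃ k ∈ K, β = (k : (Af ⊗[ℚ] V) ≃ₗ[Af] (Af ⊗[ℚ] V)) ≪≫ₗ g}
  isLevel := by
    refine ⟨g, ⟨1, one_pos, fun v w => ?_⟩, ⟨LinearEquiv.refl ℚ V, 1, ?_⟩, rfl⟩
    · rw [map_one, one_mul, g.2.1]
    · rw [bc_refl, map_one]
      exact g.2.2

/-- The identity of `V_{2d}` as a marking of `((V_{2d}, x), ψ_{2d}, gK)`. -/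
def HK.ofPointMarking (hd : 0 < d) (K : Subgroup (GAf d)) (x : Ω d) (g : GAf d)
    (hx : IsPolarizedK3OfDegree d (ψ d) (x : Rep V)) : (HK.ofPoint hd K x g hx).Marking where
  α := g.1
  α_mem := ⟨1, one_mem _, rfl⟩
  m := 1
  m_pos := one_pos
  similitude v w := by
    rw [map_one, one_mul]
    exact (g.2.1 v w).symm
  a := LinearEquiv.refl ℚ V
  form_eq v w := by
    rw [inv_one, one_mul]
    rfl
  comp_mem := (trans_bc_refl g.1).symm ▸ g.2

theorem HK.ofPointMarking_point (hd : 0 < d) (K : Subgroup (GAf d)) (x : Ω d) (g : GAf d)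
    (hx : IsPolarizedK3OfDegree d (ψ d) (x : Rep V)) :
    (HK.ofPointMarking hd K x g hx).point = Sh.mk K x g := by
  unfold HK.Marking.point
  congr 1
  · exact Subtype.ext (transport_refl _)
  · exact Subtype.ext (trans_bc_refl g.1)

/-- The signature rules out the sign `-ψ`, so every point of `Ω^±` makes `V_{2d}` itself an object
of degree `2d`. -/
theorem isPolarizedK3OfDegree_of_mem_Ω (hd : 0 < d) {x : Rep V} (hx : x ∈ Ω d) :
    IsPolarizedK3OfDegree d (ψ d) x :=
  ⟨hx.1, hx.2.1, hx.2.2.resolve_right (not_isPolarization_neg hd hx.2.1),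
    LinearEquiv.refl ℚ V, fun _ _ => rfl⟩

/-- The period map on isomorphism classes. -/
def periodMap (hd : 0 < d) (K : Subgroup (GAf d)) : Quotient (HK.setoid d K) → Sh d K :=
  Quotient.lift
    (fun X => (HK.exists_marking hd X X.level_nonempty.choose_spec).choose.point)
    (fun _ _ h => HK.Marking.point_eq_of_iso h _ _)

/-- Any marking may replace the chosen one, by invariance under the identity isomorphism. -/
theorem periodMap_mk (hd : 0 < d) {X : HK d K} (M : X.Marking) :
    periodMap hd K (Quotient.mk (HK.setoid d K) X) = M.point :=
  HK.Marking.point_eq_of_iso ((HK.setoid d K).refl X) _ _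

theorem exists_periodMap_eq (hd : 0 < d) (p : Sh d K) :
    ∃ X : HK d K, IsPolarizedK3OfDegree d X.s X.h ∧
      periodMap hd K (Quotient.mk (HK.setoid d K) X) = p := by
  obtain ⟨⟨x, g⟩, rfl⟩ := Quotient.exists_rep p
  have hx := isPolarizedK3OfDegree_of_mem_Ω hd x.2
  exact ⟨HK.ofPoint hd K x g hx, hx,
    (periodMap_mk hd (HK.ofPointMarking hd K x g hx)).trans
      (HK.ofPointMarking_point hd K x g hx)⟩

theorem periodMap_injective (hd : 0 < d) (K : Subgroup (GAf d)) :
    Function.Injective (periodMap hd K) := by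
  intro p p' h
  induction p using Quotient.inductionOn with | _ X =>
  induction p' using Quotient.inductionOn with | _ Y =>
  obtain ⟨α, hα⟩ := X.level_nonempty
  obtain ⟨β, hβ⟩ := Y.level_nonempty
  obtain ⟨M, -⟩ := X.exists_marking hd hα
  obtain ⟨N, -⟩ := Y.exists_marking hd hβ
  rw [periodMap_mk hd M, periodMap_mk hd N] at h
  exact Quotient.sound (M.iso_of_point_eq N h)

end K3Shimura

end

open K3Shimura in
theorem mainTheorem10 (d : ℕ) (hd : 0 < d) (K : Subgroup (GAf d))
    (hK_open : IsOpen (K : Set (GAf d))) (hK_compact : IsCompact (K : Set (GAf d))) :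
    -- the choices needed to form `[a · h, a ∘ α]_K` exist, for every representative `α`
    (∀ (X : HK d K), ∀ α ∈ X.level, ∃ M : X.Marking, M.α = α) ∧
    -- `[a · h, a ∘ α]_K` is a point of the Shimura variety that depends only on the isomorphism
    -- class, and the resulting map is bijective
    ∃ Φ : Quotient (HK.setoid d K) → Sh d K,
      (∀ (X : HK d K) (M : X.Marking), ∃ hΩ : transport M.a X.h ∈ Ω d,
        Φ (Quotient.mk (HK.setoid d K) X) =
          Sh.mk K ⟨transport M.a X.h, hΩ⟩ ⟨M.α ≪≫ₗ bc Af M.a, M.comp_mem⟩) ∧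
      Function.Bijective Φ ∧
      -- the objects of degree `2d` already represent all classes
      ∀ p : Sh d K, ∃ X : HK d K, IsPolarizedK3OfDegree d X.s X.h ∧
        Φ (Quotient.mk (HK.setoid d K) X) = p := by
  refine ⟨fun X α hα => X.exists_marking hd hα, periodMap hd K,
    fun X M => ⟨M.transport_mem_Ω, periodMap_mk hd M⟩, ⟨periodMap_injective hd K, fun p => ?_⟩,
    exists_periodMap_eq hd⟩
  obtain ⟨X, -, hX⟩ := exists_periodMap_eq hd p
  exact ⟨_, hX⟩
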